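/- Let $\Bbbk$ be an algebraically closed field of characteristic zero, let $N\ge 1$, $H=\Bbbk[D]$, and let $\mathrm{Cend}_N=H\otimes M_N(\Bbbk[v])=M_N(\Bbbk[D,v])$ be the associative conformal algebra whose products $\circ_n$ ($n\ge 0$) are the bilinear operations determined by $$A\circ_n B=A\,\partial_v^n(B)\quad (A,B\in M_N(\Bbbk[v])),\qquad Da\circ_n b=-n\,a\circ_{n-1}b,\qquad a\circ_n Db=D(a\circ_n b)+n\,a\circ_{n-1}b .$$ A conformal subalgebra of $\mathrm{Cend}_N$ is an $H$-submodule closed under all the products $\circ_n$. For $Q=Q(v)\in M_N(\Bbbk[v])$ put $\mathrm{Cend}_{N,Q}=M_N(\Bbbk[D,v])\,Q(v-D)$. The algebra $\mathrm{Cend}_N$ acts on the free $H$-module $V_N=\Bbbk[D]^N$ by $$\bigl(D^sA(v)\bigr)\circ_n u=(-1)^s\,n(n-1)\cdots(n-s+1)\,A(D)\,\partial_D^{\,n-s}(u)\qquad (A\in M_N(\Bbbk[v]),\ u\in V_N,\ n\ge 0),$$ where the right-hand side is $0$ for $s>n$, and a conformal subalgebra $C$ is irreducible if $V_N$ has no $H$-submodules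 stable under all operators $u\mapsto a\circ_n u$ ($a\in C$, $n\ge0$) other than $0$ and $V_N$. (1) Let $Q\in M_N(\Bbbk[v])$ with $\det Q\neq 0$, let $C\subseteq \mathrm{Cend}_N$ be a conformal subalgebra, and let $n\ge 0$. If $$\mathrm{Cend}_{N,Q}=C\oplus vC\oplus\dots\oplus v^nC ,$$ then $n=0$. (2) Consequently, there is no irreducible conformal subalgebra $C\subseteq\mathrm{Cend}_N$ such that $C\cap vC=0$ but the sum $\sum_{n\ge 0}v^nC$ is not direct. -/

import Mathlib

open Polynomial

noncomputable section

namespace Conformal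

/-- The underlying space of `Cend_N`: `H ⊗ M_N(k[v]) = M_N(k[D, v])`, where `H = k[D]`.
The outer polynomial variable is `D`; the coefficients are `N × N` matrices over `k[v]`.
The ring structure of this type is the usual multiplication of `M_N(k[D, v])`. -/
abbrev Cend (k : Type*) [Field k] (N : ℕ) : Type _ :=
  Polynomial (Matrix (Fin N) (Fin N) k[X])

variable {k : Type*} [Field k] {N : ℕ}

/-- The entrywise `m`-th derivative `∂_v^m` on `M_N(k[v])`. -/
def matDeriv (m : ℕ) (B : Matrix (Fin N) (Fin N) k[X]) : Matrix (Fin N) (Fin N) k[X] :=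
  B.map fun f => derivative^[m] f

/-- The `n`-th conformal product of `Cend_N`: the biadditive sesquilinear extension of
`A ∘_n B = A ∂_v^n(B)`, `A, B ∈ M_N(k[v])`. Explicitly
`D^i A ∘_n D^j B = ∑_s (-1)^i n(n-1)⋯(n-i-s+1) (j choose s) D^(j-s) A ∂_v^(n-i-s)(B)`,
with vanishing terms for `i + s > n`. -/
def nProd (n : ℕ) (a b : Cend k N) : Cend k N :=
  a.sum fun i A => b.sum fun j B => ∑ s ∈ Finset.range (j + 1),
    monomial (j - s)
      (((-1) ^ i * (n.descFactorial (i + s) : k) * (j.choose s : k)) •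
        (A * matDeriv (n - (i + s)) B))

/-- Multiplication by `v` on `Cend_N`. -/
def vMul : Cend k N →ₗ[k] Cend k N where
  toFun a := (X : k[X]) • a
  map_add' := smul_add _
  map_smul' c a := smul_comm _ c a

/-- `v^i C` for a subspace `C` of `Cend_N`. -/
def vPow (i : ℕ) (C : Submodule k (Cend k N)) : Submodule k (Cend k N) :=
  C.map (vMul ^ i)

/-- A conformal subalgebra of `Cend_N`: a subspace closed under `D` and under all products. -/
structure IsConformalSubalgebra (C : Submodule k (Cend k N)) : Prop where
  D_mem : ∀ a ∈ C, X * a ∈ C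
  nProd_mem : ∀ (n : ℕ), ∀ a ∈ C, ∀ b ∈ C, nProd n a b ∈ C

/-- `Q(v - D)`, an element of `M_N(k[D, v])`, for `Q ∈ M_N(k[v])`. -/
def shift (Q : Matrix (Fin N) (Fin N) k[X]) : Cend k N :=
  ∑ i, ∑ j,
    aeval (C (Matrix.scalar (Fin N) (X : k[X])) - X : Cend k N) (Q i j) *
      C (Matrix.single i j 1)

/-- `Cend_{N,Q} = M_N(k[D, v]) Q(v - D)`. -/
def CendQ (Q : Matrix (Fin N) (Fin N) k[X]) : Submodule k (Cend k N) :=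
  LinearMap.range (LinearMap.mulRight k (shift Q))

/-- The action `u ↦ a ∘_n u` of `a ∈ Cend_N` on the free `H`-module `V_N = k[D]^N`:
`(D^s A) ∘_n u = (-1)^s n(n-1)⋯(n-s+1) A(D) ∂_D^(n-s)(u)`, extended additively. -/
def act (n : ℕ) (a : Cend k N) (u : Fin N → k[X]) : Fin N → k[X] :=
  a.sum fun s A => ((-1) ^ s * (n.descFactorial s : k)) •
    A.mulVec fun i => derivative^[n - s] (u i)

/-- `C` is irreducible: `V_N` has no `H`-submodules stable under all the operators `a ∘_n`,
`a ∈ C`, other than `0` and `V_N`. -/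
def IsIrreducible (C : Submodule k (Cend k N)) : Prop :=
  ∀ U : Submodule k[X] (Fin N → k[X]),
    (∀ a ∈ C, ∀ (n : ℕ), ∀ u ∈ U, act n a u ∈ U) → U = ⊥ ∨ U = ⊤

end Conformal

end

noncomputable section

namespace Conformal

variable {k : Type*} [Field k] {N : ℕ}

/-! The core is `iSupIndep_vPow_of_isIrreducible`: if `C` is irreducible and `C ∩ vC = 0`, then the
sum of all `v^i C` is direct. This is (2). It gives (1) as follows. `Cend_{N,Q}` is irreducible, and
`v` acts on `V_N` as multiplication by `D`, so `C` is irreducible too. If `n ≥ 1`, then `C ∩ vC = 0`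
and all powers are independent; but `v^(n+1) C` lies in `Cend_{N,Q}`, the sum of the lower ones, so
`C = 0`, which is absurd.

The core is a Schur lemma argument. In a first dependence write the leading terms as `v^(n+1) a ≡
(n+1) v^n c` modulo lower powers (`LeadingRel`). Independence up to `v^n` makes `c` a function of
`a`, and multiplying the relation by elements of `C` shows that `ψ(a) = va - c` commutes with left
and right products. The assignment `a ∘_m u ↦ c ∘_m u` then spans the graph of an `H`-linear
operator `θ` on `V_N`: irreducibility makes its domain everything and its fibre over 0 trivial. The
operator `T = D - θ` commutes with `C`. For a suitable scalar `α`, `T - α` is not surjective; its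
image is a submodule, hence zero. Faithfulness yields `va = c + αa ∈ C ∩ vC = 0`, so `a = 0`. -/

/-! ### Derivatives of matrices and bilinearity of the action -/

lemma matDeriv_add (m : ℕ) (A B : Matrix (Fin N) (Fin N) k[X]) :
    matDeriv m (A + B) = matDeriv m A + matDeriv m B := by
  ext1 i j
  simp [matDeriv]

lemma matDeriv_zero (m : ℕ) : matDeriv m (0 : Matrix (Fin N) (Fin N) k[X]) = 0 := by
  ext1 i j
  simp [matDeriv]

lemma matDeriv_smul (m : ℕ) (c : k) (A : Matrix (Fin N) (Fin N) k[X]) :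
    matDeriv m (c • A) = c • matDeriv m A := by
  ext1 i j
  simp [matDeriv]

lemma iterate_derivative_X_mul' (m : ℕ) (p : k[X]) :
    derivative^[m] (X * p) = X * derivative^[m] p + m • derivative^[m - 1] p := by
  rw [mul_comm, iterate_derivative_mul_X, mul_comm]

lemma matDeriv_X_smul (m : ℕ) (A : Matrix (Fin N) (Fin N) k[X]) :
    matDeriv m ((X : k[X]) • A) = (X : k[X]) • matDeriv m A + m • matDeriv (m - 1) A := by
  ext1 i j
  simp only [matDeriv, Matrix.map_apply, Matrix.smul_apply, Matrix.add_apply, smul_eq_mul,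
    iterate_derivative_X_mul']

lemma act_add_left (n : ℕ) (a b : Cend k N) (u : Fin N → k[X]) :
    act n (a + b) u = act n a u + act n b u := by
  unfold act
  rw [Polynomial.sum_add_index] <;> simp [Matrix.add_mulVec]

lemma act_monomial (n s : ℕ) (A : Matrix (Fin N) (Fin N) k[X]) (u : Fin N → k[X]) :
    act n (monomial s A) u = ((-1) ^ s * (n.descFactorial s : k)) •
      A.mulVec fun i => derivative^[n - s] (u i) := by
  unfold act
  rw [Polynomial.sum_monomial_index]
  simp

lemma act_smul_left (n : ℕ) (c : k) (a : Cend k N) (u : Fin N → k[X]) :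
    act n (c • a) u = c • act n a u := by
  induction a using Polynomial.induction_on' with
  | add p q hp hq => rw [smul_add, act_add_left, act_add_left, hp, hq, smul_add]
  | monomial s A =>
    rw [smul_monomial, act_monomial, act_monomial, Matrix.smul_mulVec, smul_comm]

lemma act_add_right (n : ℕ) (a : Cend k N) (u w : Fin N → k[X]) :
    act n a (u + w) = act n a u + act n a w := by
  induction a using Polynomial.induction_on' with
  | add p q hp hq => simp only [act_add_left, hp, hq]; abel
  | monomial s A =>
    simp only [act_monomial, ← smul_add, ← Matrix.mulVec_add]
    congr 2
    ext1 i
    simp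

lemma act_smul_right (n : ℕ) (a : Cend k N) (c : k) (u : Fin N → k[X]) :
    act n a (c • u) = c • act n a u := by
  induction a using Polynomial.induction_on' with
  | add p q hp hq => simp only [act_add_left, hp, hq, smul_add]
  | monomial s A =>
    have h : (fun i => derivative^[n - s] ((c • u) i)) =
        c • fun i => derivative^[n - s] (u i) := by
      ext1 i
      simp
    rw [act_monomial, act_monomial, h, Matrix.mulVec_smul, smul_comm]

/-- The action of `Cend k N` on `V_N` as a bilinear map. -/
def actHom (n : ℕ) : Cend k N →ₗ[k] (Fin N → k[X]) →ₗ[k] (Fin N → k[X]) :=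
  LinearMap.mk₂ k (act n) (act_add_left n) (act_smul_left n) (act_add_right n)
    (fun c a u => act_smul_right n a c u)

lemma actHom_apply (n : ℕ) (a : Cend k N) (u : Fin N → k[X]) : actHom n a u = act n a u := rfl

lemma actHom_monomial (n s : ℕ) (A : Matrix (Fin N) (Fin N) k[X]) (u : Fin N → k[X]) :
    actHom n (monomial s A) u = ((-1) ^ s * (n.descFactorial s : k)) •
      A.mulVec fun i => derivative^[n - s] (u i) :=
  act_monomial n s A u

/-! ### Bilinearity of the conformal products -/

/-- The summand of `nProd` for a pair of monomials. -/
def monomialProd (n i j : ℕ) (A B : Matrix (Fin N) (Fin N) k[X]) : Cend k N :=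
  ∑ s ∈ Finset.range (j + 1), monomial (j - s)
      (((-1) ^ i * (n.descFactorial (i + s) : k) * (j.choose s : k)) •
        (A * matDeriv (n - (i + s)) B))

lemma monomialProd_add_right (n i j : ℕ) (A B B' : Matrix (Fin N) (Fin N) k[X]) :
    monomialProd n i j A (B + B') = monomialProd n i j A B + monomialProd n i j A B' := by
  simp only [monomialProd, matDeriv_add, mul_add, smul_add, map_add, Finset.sum_add_distrib]

lemma monomialProd_add_left (n i j : ℕ) (A A' B : Matrix (Fin N) (Fin N) k[X]) :
    monomialProd n i j (A + A') B = monomialProd n i j A B + monomialProd n i j A' B := by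
  simp only [monomialProd, add_mul, smul_add, map_add, Finset.sum_add_distrib]

lemma monomialProd_smul_right (n i j : ℕ) (c : k) (A B : Matrix (Fin N) (Fin N) k[X]) :
    monomialProd n i j A (c • B) = c • monomialProd n i j A B := by
  simp only [monomialProd, matDeriv_smul, Matrix.mul_smul, Finset.smul_sum, smul_monomial]
  simp only [smul_comm c]

lemma monomialProd_smul_left (n i j : ℕ) (c : k) (A B : Matrix (Fin N) (Fin N) k[X]) :
    monomialProd n i j (c • A) B = c • monomialProd n i j A B := by
  simp only [monomialProd, Matrix.smul_mul, Finset.smul_sum, smul_monomial]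
  simp only [smul_comm c]

lemma monomialProd_zero_left (n i j : ℕ) (B : Matrix (Fin N) (Fin N) k[X]) :
    monomialProd n i j 0 B = 0 := by
  simp [monomialProd]

lemma monomialProd_zero_right (n i j : ℕ) (A : Matrix (Fin N) (Fin N) k[X]) :
    monomialProd n i j A 0 = 0 := by
  simp [monomialProd, matDeriv_zero]

lemma nProd_eq_sum (n : ℕ) (a b : Cend k N) :
    nProd n a b = a.sum fun i A => b.sum fun j B => monomialProd n i j A B := rfl

lemma nProd_add_left (n : ℕ) (a a' b : Cend k N) :
    nProd n (a + a') b = nProd n a b + nProd n a' b := by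
  simp only [nProd_eq_sum]
  rw [Polynomial.sum_add_index]
  · intro i
    simp [Polynomial.sum, monomialProd_zero_left]
  · intro i A A'
    simp only [Polynomial.sum, monomialProd_add_left, Finset.sum_add_distrib]

lemma nProd_add_right (n : ℕ) (a b b' : Cend k N) :
    nProd n a (b + b') = nProd n a b + nProd n a b' := by
  simp only [nProd_eq_sum]
  simp only [Polynomial.sum_def (p := a), ← Finset.sum_add_distrib]
  refine Finset.sum_congr rfl fun i _ => ?_
  rw [Polynomial.sum_add_index]
  · intro i
    simp [monomialProd_zero_right]
  · intro i A A'
    simp only [monomialProd_add_right]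

lemma nProd_monomial (n i j : ℕ) (A B : Matrix (Fin N) (Fin N) k[X]) :
    nProd n (monomial i A) (monomial j B) = monomialProd n i j A B := by
  rw [nProd_eq_sum, Polynomial.sum_monomial_index, Polynomial.sum_monomial_index]
  · exact monomialProd_zero_right ..
  · simp [Polynomial.sum, monomialProd_zero_left]

/-- Two biadditive maps on polynomials agree when they agree on monomials. -/
lemma monomial_induction₂ {R : Type*} [Semiring R] {p : R[X] → R[X] → Prop}
    (hl : ∀ a a' b, p a b → p a' b → p (a + a') b)
    (hr : ∀ a b b', p a b → p a b' → p a (b + b'))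
    (hm : ∀ i j A B, p (monomial i A) (monomial j B)) (a b : R[X]) : p a b := by
  induction a using Polynomial.induction_on' with
  | add a a' ha ha' => exact hl _ _ _ ha ha'
  | monomial i A =>
    induction b using Polynomial.induction_on' with
    | add b b' hb hb' => exact hr _ _ _ hb hb'
    | monomial j B => exact hm i j A B

lemma nProd_smul_left (n : ℕ) (c : k) (a b : Cend k N) :
    nProd n (c • a) b = c • nProd n a b := by
  refine monomial_induction₂ (p := fun a b : Cend k N => nProd n (c • a) b = c • nProd n a b)
    (fun a a' b h h' => ?_) (fun a b b' h h' => ?_) (fun i j A B => ?_) a b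
  · rw [smul_add, nProd_add_left, nProd_add_left, h, h', smul_add]
  · rw [nProd_add_right, nProd_add_right, h, h', smul_add]
  · rw [smul_monomial, nProd_monomial, nProd_monomial, monomialProd_smul_left]

lemma nProd_smul_right (n : ℕ) (c : k) (a b : Cend k N) :
    nProd n a (c • b) = c • nProd n a b := by
  refine monomial_induction₂ (p := fun a b : Cend k N => nProd n a (c • b) = c • nProd n a b)
    (fun a a' b h h' => ?_) (fun a b b' h h' => ?_) (fun i j A B => ?_) a b
  · rw [nProd_add_left, nProd_add_left, h, h', smul_add]
  · rw [smul_add, nProd_add_right, nProd_add_right, h, h', smul_add]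
  · rw [smul_monomial, nProd_monomial, nProd_monomial, monomialProd_smul_right]

/-- The `n`-th conformal product as a bilinear map. -/
def nProdHom (n : ℕ) : Cend k N →ₗ[k] Cend k N →ₗ[k] Cend k N :=
  LinearMap.mk₂ k (nProd n) (nProd_add_left n) (nProd_smul_left n) (nProd_add_right n)
    (fun c a b => nProd_smul_right n c a b)

lemma nProdHom_monomial (n i j : ℕ) (A B : Matrix (Fin N) (Fin N) k[X]) :
    nProdHom n (monomial i A) (monomial j B) = monomialProd n i j A B :=
  nProd_monomial ..

/-! ### How `D` and `v` pass through the products -/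

lemma vMul_monomial (i : ℕ) (A : Matrix (Fin N) (Fin N) k[X]) :
    vMul (monomial i A : Cend k N) = monomial i ((X : k[X]) • A) :=
  smul_monomial _ _ _

lemma nProdHom_vMul_left (n : ℕ) (a b : Cend k N) :
    nProdHom n (vMul a) b = vMul (nProdHom n a b) := by
  refine monomial_induction₂
    (p := fun a b : Cend k N => nProdHom n (vMul a) b = vMul (nProdHom n a b))
    (fun a a' b h h' => ?_) (fun a b b' h h' => ?_) (fun i j A B => ?_) a b
  · simp only [map_add, LinearMap.add_apply, h, h']
  · simp only [map_add, h, h']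
  · simp only [vMul_monomial, nProdHom_monomial, monomialProd, map_sum]
    refine Finset.sum_congr rfl fun s _ => ?_
    rw [Matrix.smul_mul, smul_comm]

lemma descFactorial_mul_sub (n i : ℕ) :
    n.descFactorial i * (n - i) = n * (n - 1).descFactorial i := by
  rw [mul_comm, ← Nat.descFactorial_succ]
  cases n with
  | zero => simp
  | succ n => rw [Nat.succ_descFactorial_succ]; rfl

lemma nProdHom_vMul_right (n : ℕ) (a b : Cend k N) :
    nProdHom n a (vMul b) = vMul (nProdHom n a b) + n • nProdHom (n - 1) a b := by
  refine monomial_induction₂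
    (p := fun a b : Cend k N =>
      nProdHom n a (vMul b) = vMul (nProdHom n a b) + n • nProdHom (n - 1) a b)
    (fun a a' b h h' => ?_) (fun a b b' h h' => ?_) (fun i j A B => ?_) a b
  · simp only [map_add, LinearMap.add_apply, h, h', smul_add]; abel
  · simp only [map_add, h, h', smul_add]; abel
  · simp only [vMul_monomial, nProdHom_monomial, monomialProd, map_sum, Finset.smul_sum,
      ← Finset.sum_add_distrib]
    refine Finset.sum_congr rfl fun s _ => ?_
    rw [matDeriv_X_smul, mul_add, smul_add, map_add, Matrix.mul_smul, smul_comm,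
      smul_monomial n, Nat.sub_right_comm n 1]
    congr 2
    simp only [Matrix.mul_smul, ← Nat.cast_smul_eq_nsmul k, smul_smul]
    congr 1
    have := congrArg (Nat.cast : ℕ → k) (descFactorial_mul_sub n (i + s))
    push_cast at this
    linear_combination ((-1) ^ i * (j.choose s : k)) * this

lemma X_mul_monomial' {R : Type*} [Semiring R] (i : ℕ) (A : R) :
    (X : R[X]) * monomial i A = monomial (i + 1) A := by
  rw [X_mul_monomial]

lemma nProdHom_X_mul_left (n : ℕ) (a b : Cend k N) :
    nProdHom n (X * a) b = -(n • nProdHom (n - 1) a b) := by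
  refine monomial_induction₂
    (p := fun a b : Cend k N => nProdHom n (X * a) b = -(n • nProdHom (n - 1) a b))
    (fun a a' b h h' => ?_) (fun a b b' h h' => ?_) (fun i j A B => ?_) a b
  · simp only [mul_add, map_add, LinearMap.add_apply, h, h', smul_add]; abel
  · simp only [map_add, h, h', smul_add]; abel
  · simp only [X_mul_monomial', nProdHom_monomial, monomialProd, Finset.smul_sum,
      ← Finset.sum_neg_distrib]
    refine Finset.sum_congr rfl fun s _ => ?_
    rw [show n - (i + 1 + s) = n - 1 - (i + s) by omega, smul_monomial n, ← map_neg,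
      ← Nat.cast_smul_eq_nsmul k, smul_smul, ← neg_smul]
    congr 2
    have : (n.descFactorial (i + 1 + s) : k) = n * (n - 1).descFactorial (i + s) := by
      rw [← Nat.cast_mul, ← descFactorial_mul_sub, mul_comm, ← Nat.descFactorial_succ,
        Nat.add_right_comm]
    rw [this]
    ring

lemma nProdHom_X_mul_right (n : ℕ) (a b : Cend k N) :
    nProdHom n a (X * b) = X * nProdHom n a b + n • nProdHom (n - 1) a b := by
  refine monomial_induction₂
    (p := fun a b : Cend k N =>
      nProdHom n a (X * b) = X * nProdHom n a b + n • nProdHom (n - 1) a b)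
    (fun a a' b h h' => ?_) (fun a b b' h h' => ?_) (fun i j A B => ?_) a b
  · simp only [mul_add, map_add, LinearMap.add_apply, h, h', smul_add]; abel
  · simp only [mul_add, map_add, h, h', smul_add]; abel
  · simp only [X_mul_monomial', nProdHom_monomial, monomialProd, Finset.smul_sum, Finset.mul_sum]
    rw [Finset.sum_range_succ' _ (j + 1), Finset.sum_range_succ' (fun s => monomial (j - s + 1) _) j]
    -- Pascal's rule splits the binomial coefficient: one part belongs to `D (a ∘_n b)`, the other
    -- to `n (a ∘_(n-1) b)`.
    have h : ∀ s, (monomial (j + 1 - (s + 1)) ((((-1) ^ i * (n.descFactorial (i + (s + 1)) : k)) *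
          ((j + 1).choose (s + 1) : k)) • (A * matDeriv (n - (i + (s + 1))) B)) : Cend k N) =
        monomial (j - s) (((-1) ^ i * (n.descFactorial (i + (s + 1)) : k) *
          (j.choose (s + 1) : k)) • (A * matDeriv (n - (i + (s + 1))) B)) +
        n • monomial (j - s) (((-1) ^ i * ((n - 1).descFactorial (i + s) : k) *
          (j.choose s : k)) • (A * matDeriv (n - 1 - (i + s)) B)) := by
      intro s
      have h1 : (n.descFactorial (i + (s + 1)) : k) = n * (n - 1).descFactorial (i + s) := by
        rw [← Nat.cast_mul, ← descFactorial_mul_sub, mul_comm, ← Nat.descFactorial_succ]; rfl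
      rw [smul_monomial n, ← Nat.cast_smul_eq_nsmul k, smul_smul,
        show n - 1 - (i + s) = n - (i + (s + 1)) by omega, ← map_add, ← add_smul,
        show j + 1 - (s + 1) = j - s by omega, h1, Nat.choose_succ_succ]
      congr 2
      push_cast
      ring
    rw [Finset.sum_congr rfl fun s _ => h s, Finset.sum_add_distrib, Finset.sum_range_succ]
    have h0 : (j.choose (j + 1) : k) = 0 := by simp
    rw [h0, mul_zero, zero_smul, monomial_zero_right, add_zero, add_right_comm]
    congr 2
    · refine Finset.sum_congr rfl fun s hs => ?_
      rw [Finset.mem_range] at hs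
      rw [show j - (s + 1) + 1 = j - s by omega]
    · simp

/-! ### The action on `V_N`: sesquilinearity, faithfulness, associativity -/

lemma actHom_X_mul (n : ℕ) (a : Cend k N) (u : Fin N → k[X]) :
    actHom n (X * a) u = -(n • actHom (n - 1) a u) := by
  induction a using Polynomial.induction_on' with
  | add p q hp hq => rw [mul_add, map_add, LinearMap.add_apply, hp, hq, map_add]; simp; abel
  | monomial s A =>
    rw [X_mul_monomial', actHom_monomial, actHom_monomial, Nat.add_comm s 1, ← Nat.sub_sub,
      ← Nat.cast_smul_eq_nsmul k, smul_smul, ← neg_smul]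
    congr 1
    have : (n.descFactorial (1 + s) : k) = n * (n - 1).descFactorial s := by
      rw [← Nat.cast_mul, ← descFactorial_mul_sub, mul_comm, ← Nat.descFactorial_succ,
        Nat.add_comm]
    rw [this]
    ring

lemma actHom_vMul (n : ℕ) (a : Cend k N) (u : Fin N → k[X]) :
    actHom n (vMul a) u = (X : k[X]) • actHom n a u := by
  induction a using Polynomial.induction_on' with
  | add p q hp hq => simp only [map_add, LinearMap.add_apply, hp, hq, smul_add]
  | monomial s A =>
    rw [vMul_monomial, actHom_monomial, actHom_monomial, Matrix.smul_mulVec, smul_comm]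

lemma actHom_X_smul (n : ℕ) (a : Cend k N) (u : Fin N → k[X]) :
    actHom n a ((X : k[X]) • u) = (X : k[X]) • actHom n a u + n • actHom (n - 1) a u := by
  induction a using Polynomial.induction_on' with
  | add p q hp hq => simp only [map_add, LinearMap.add_apply, hp, hq, smul_add]; abel
  | monomial s A =>
    have h : (fun i => derivative^[n - s] (((X : k[X]) • u) i)) =
        (X : k[X]) • (fun i => derivative^[n - s] (u i)) +
          ((n - s : ℕ) : k) • fun i => derivative^[n - s - 1] (u i) := by
      ext1 i
      simp only [Pi.smul_apply, Pi.add_apply, smul_eq_mul, iterate_derivative_X_mul',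
        Nat.cast_smul_eq_nsmul]
    simp only [actHom_monomial]
    rw [h, Matrix.mulVec_add, smul_add, Matrix.mulVec_smul, smul_comm, Matrix.mulVec_smul,
      ← Nat.cast_smul_eq_nsmul k, smul_smul, smul_smul, Nat.sub_right_comm]
    congr 2
    have := congrArg (Nat.cast : ℕ → k) (descFactorial_mul_sub n s)
    push_cast at this
    linear_combination (-1) ^ s * this

/-- On a constant vector `∘_n` sees only the coefficient of `D^n`: lower ones meet a derivative of a
constant, higher ones a vanishing falling factorial. The surviving factor `± n!` is invertible. -/
lemma actHom_faithful [CharZero k] {a : Cend k N} (h : ∀ n u, actHom n a u = 0) : a = 0 := by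
  ext1 n
  rw [coeff_zero]
  have key : ∀ (b : Cend k N) (j : Fin N), actHom n b (Pi.single j 1) =
      ((-1) ^ n * (n.factorial : k)) • (b.coeff n).mulVec (Pi.single j 1) := by
    intro b j
    induction b using Polynomial.induction_on' with
    | add p q hp hq => simp only [map_add, LinearMap.add_apply, hp, hq, coeff_add,
        Matrix.add_mulVec, smul_add]
    | monomial s A =>
      rw [actHom_monomial, coeff_monomial]
      rcases lt_trichotomy s n with hs | rfl | hs
      · have : (fun i => derivative^[n - s] ((Pi.single j 1 : Fin N → k[X]) i)) = 0 := by
          ext1 i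
          rw [Pi.single_apply]
          split_ifs
          · exact iterate_derivative_one (by omega)
          · simp
        rw [this, if_neg hs.ne, Matrix.zero_mulVec]
        simp
      · simp [Nat.descFactorial_self]
      · rw [Nat.descFactorial_of_lt hs, if_neg hs.ne', Matrix.zero_mulVec]
        simp
  ext1 i j
  have h1 := key a j
  rw [h] at h1
  have hc : ((-1) ^ n * (n.factorial : k)) ≠ 0 :=
    mul_ne_zero (pow_ne_zero _ (by simp)) (Nat.cast_ne_zero.2 n.factorial_ne_zero)
  have h2 := congrFun ((smul_eq_zero.1 h1.symm).resolve_left hc) i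
  simpa using h2

/-- The absorption identity for binomials. For `m = 0` the truncated range keeps one term, killed by
the factor `m`. -/
lemma sum_choose_smul {M : Type*} [AddCommMonoid M] (m : ℕ) (f : ℕ → M) :
    ∑ s ∈ Finset.range (m + 1), m.choose s • s • f s =
      m • ∑ s ∈ Finset.range (m - 1 + 1), (m - 1).choose s • f (s + 1) := by
  cases m with
  | zero => simp
  | succ m =>
    rw [Finset.sum_range_succ', zero_smul, smul_zero, add_zero, Finset.smul_sum]
    refine Finset.sum_congr rfl fun s _ => ?_
    rw [smul_smul, smul_smul, Nat.add_sub_cancel, Nat.add_one_mul_choose_eq]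

/-- For coefficients free of `D` this is the Leibniz rule for `∂^m (A ∂^l u)`. -/
lemma actHom_actHom_const (m l : ℕ) (B A : Matrix (Fin N) (Fin N) k[X]) (u : Fin N → k[X]) :
    actHom m (monomial 0 B) (actHom l (monomial 0 A) u) =
      ∑ s ∈ Finset.range (m + 1), m.choose s •
        actHom (m + l - s) (nProdHom s (monomial 0 B) (monomial 0 A)) u := by
  have hn : ∀ s, nProdHom s (monomial 0 B : Cend k N) (monomial 0 A) =
      monomial 0 (B * matDeriv s A) := by
    intro s
    rw [nProdHom_monomial, monomialProd, Finset.sum_range_one]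
    simp
  have ha : ∀ (n : ℕ) (A : Matrix (Fin N) (Fin N) k[X]) (w : Fin N → k[X]),
      actHom n (monomial 0 A) w = A.mulVec fun i => derivative^[n] (w i) := by
    intro n A w
    rw [actHom_monomial]
    simp
  simp only [hn, ha, ← Matrix.mulVec_mulVec, ← Matrix.mulVec_smul, ← Matrix.mulVec_sum]
  congr 1
  ext1 i
  rw [Finset.sum_apply]
  simp only [Matrix.mulVec, dotProduct, Pi.smul_apply, iterate_derivative_sum, matDeriv,
    Matrix.map_apply]
  rw [Finset.sum_comm]
  refine Finset.sum_congr rfl fun j _ => ?_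
  rw [mul_comm, iterate_derivative_mul]
  refine Finset.sum_congr rfl fun s hs => ?_
  rw [← Function.iterate_add_apply, mul_comm]
  have := Finset.mem_range.1 hs
  rw [show m + l - s = m - s + l by omega, mul_smul_comm]

/-- Associativity of the conformal action. -/
lemma actHom_actHom (m l : ℕ) (b a : Cend k N) (u : Fin N → k[X]) :
    actHom m b (actHom l a u) =
      ∑ s ∈ Finset.range (m + 1), m.choose s • actHom (m + l - s) (nProdHom s b a) u := by
  refine monomial_induction₂ (p := fun b a : Cend k N => ∀ m l, actHom m b (actHom l a u) =
      ∑ s ∈ Finset.range (m + 1), m.choose s • actHom (m + l - s) (nProdHom s b a) u)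
    (fun b b' a h h' m l => ?_) (fun b a a' h h' m l => ?_) (fun i j B A => ?_) b a m l
  · simp only [map_add, LinearMap.add_apply, h, h', smul_add, Finset.sum_add_distrib]
  · simp only [map_add, LinearMap.add_apply, h, h', smul_add, Finset.sum_add_distrib]
  · induction i with
    | zero =>
      induction j with
      | zero => exact fun m l => actHom_actHom_const m l B A u
      | succ j ih =>
        intro m l
        simp only [← X_mul_monomial' j, actHom_X_mul, nProdHom_X_mul_right, map_add,
          LinearMap.add_apply, smul_add, Finset.sum_add_distrib, map_neg, map_nsmul,
          LinearMap.smul_apply]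
        rw [sum_choose_smul (f := fun s => actHom (m + l - s)
          (nProdHom (s - 1) (monomial 0 B) (monomial j A)) u), ih, Finset.smul_sum,
          Finset.smul_sum]
        simp only [smul_neg, Nat.add_sub_cancel]
        -- The factor `m + l - s` is split as `l + (m - s)`: the first part is the induction
        -- hypothesis, the second cancels the lowered products, by `h2`.
        have h1 : ∀ s ∈ Finset.range (m + 1), m.choose s • (m + l - s) •
            actHom (m + l - s - 1) (nProdHom s (monomial 0 B) (monomial j A)) u =
            l • m.choose s • actHom (m + (l - 1) - s)
              (nProdHom s (monomial 0 B) (monomial j A)) u +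
            (m.choose s * (m - s)) • actHom (m + l - (s + 1))
              (nProdHom s (monomial 0 B) (monomial j A)) u := by
          intro s hs
          have hs := Finset.mem_range.1 hs
          rw [smul_comm l, mul_smul, ← smul_add]
          congr 1
          cases l with
          | zero => simp [Nat.sub_sub]
          | succ l =>
            rw [show m + (l + 1) - s - 1 = m + l - s by omega,
              show m + (l + 1 - 1) - s = m + l - s by omega,
              show m + (l + 1) - (s + 1) = m + l - s by omega, ← add_smul]
            congr 1
            omega
        have h2 : ∑ s ∈ Finset.range (m + 1), (m.choose s * (m - s)) •
            actHom (m + l - (s + 1)) (nProdHom s (monomial 0 B) (monomial j A)) u =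
            ∑ s ∈ Finset.range (m - 1 + 1), m • (m - 1).choose s •
            actHom (m + l - (s + 1)) (nProdHom s (monomial 0 B) (monomial j A)) u := by
          cases m with
          | zero => simp
          | succ m =>
            rw [Finset.sum_range_succ, Nat.sub_self, mul_zero, zero_smul, add_zero]
            refine Finset.sum_congr rfl fun s _ => ?_
            rw [smul_smul, Nat.add_sub_cancel, Nat.add_one_mul_choose_eq,
              Nat.choose_succ_right_eq]
        rw [Finset.sum_neg_distrib, Finset.sum_congr rfl h1, Finset.sum_add_distrib, h2]
        abel
    | succ i ih =>
      intro m l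
      simp only [← X_mul_monomial' i, actHom_X_mul, nProdHom_X_mul_left, map_neg, map_nsmul,
        LinearMap.neg_apply, LinearMap.smul_apply, smul_neg, Finset.sum_neg_distrib]
      rw [sum_choose_smul (f := fun s => actHom (m + l - s)
          (nProdHom (s - 1) (monomial i B) (monomial j A)) u), ih]
      cases m with
      | zero => simp
      | succ m =>
        congr 2
        refine Finset.sum_congr rfl fun s _ => ?_
        rw [show m + 1 - 1 + l - s = m + 1 + l - (s + 1) by omega, Nat.add_sub_cancel, Nat.add_sub_cancel]

/-! ### Right multiplication by `Q(v - D)` and irreducibility of `Cend_{N,Q}` -/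

lemma actHom_mul_C_map (n : ℕ) (a : Cend k N) (E : Matrix (Fin N) (Fin N) k)
    (u : Fin N → k[X]) :
    actHom n (a * C (E.map C)) u = actHom n a ((E.map C).mulVec u) := by
  induction a using Polynomial.induction_on' with
  | add p q hp hq => simp only [add_mul, map_add, LinearMap.add_apply, hp, hq]
  | monomial s A =>
    rw [monomial_mul_C, actHom_monomial, actHom_monomial, ← Matrix.mulVec_mulVec]
    congr 2
    ext1 i
    simp [Matrix.mulVec, dotProduct, iterate_derivative_sum, iterate_derivative_C_mul]

/-- The variable `v - D` of the right-hand factor of `CendQ`. -/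
def rightVar : Cend k N := C (Matrix.scalar (Fin N) (X : k[X])) - X

lemma mul_rightVar (a : Cend k N) : a * rightVar = vMul a - X * a := by
  rw [rightVar, mul_sub, X_mul]
  congr 1
  induction a using Polynomial.induction_on' with
  | add p q hp hq => rw [map_add, ← hp, ← hq, add_mul]
  | monomial s A =>
    rw [monomial_mul_C, vMul_monomial, Matrix.scalar_apply, ← Matrix.smul_eq_mul_diagonal]

/-- This explains `v - D`: the term `n a ∘_(n-1) u` produced by `-D` is the commutator of `a ∘_n`
with `D`. -/
lemma actHom_mul_rightVar (n : ℕ) (a : Cend k N) (u : Fin N → k[X]) :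
    actHom n (a * rightVar) u = actHom n a ((X : k[X]) • u) := by
  rw [mul_rightVar, map_sub, LinearMap.sub_apply, actHom_vMul, actHom_X_mul, actHom_X_smul,
    sub_neg_eq_add]

lemma actHom_mul_aeval (n : ℕ) (a : Cend k N) (q : k[X]) (u : Fin N → k[X]) :
    actHom n (a * aeval rightVar q) u = actHom n a (q • u) := by
  induction q using Polynomial.induction_on generalizing u with
  | C c =>
    rw [aeval_C, ← Algebra.commutes, ← Algebra.smul_def, map_smul, ← algebraMap_eq,
      algebraMap_smul, map_smul, LinearMap.smul_apply]
  | add p q hp hq => rw [map_add, mul_add, map_add, LinearMap.add_apply, hp, hq, add_smul, map_add]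
  | monomial m c h =>
    rw [pow_succ, ← mul_assoc, map_mul (aeval rightVar), aeval_X, ← mul_assoc, actHom_mul_rightVar, h, mul_smul _ X]

lemma actHom_mul_shift (n : ℕ) (a : Cend k N) (Q : Matrix (Fin N) (Fin N) k[X])
    (u : Fin N → k[X]) :
    actHom n (a * shift Q) u = actHom n a (Q.mulVec u) := by
  have h : Q.mulVec u = ∑ i, ∑ j, Q i j • (((Matrix.single i j (1 : k)).map C).mulVec u) := by
    conv_lhs => rw [Matrix.matrix_eq_sum_single Q]
    simp only [Matrix.sum_mulVec, ← Matrix.smul_mulVec]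
    refine Finset.sum_congr rfl fun i _ => Finset.sum_congr rfl fun j _ => ?_
    congr 1
    rw [Matrix.map_single]
    simp [Matrix.smul_single]
  rw [h, shift]
  simp only [map_sum, Finset.mul_sum, LinearMap.sum_apply]
  refine Finset.sum_congr rfl fun i _ => Finset.sum_congr rfl fun j _ => ?_
  rw [← actHom_mul_aeval, ← actHom_mul_C_map, mul_assoc, Matrix.map_single, map_one]
  rfl

/-- For `u ≠ 0` in `U`, some entry `j` of `Qu` is nonzero, of degree `d` say. Then `E_ij Q(v - D)`
sends `u` under `∘_d` to a nonzero constant multiple of `e_i`. -/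
lemma CendQ_isIrreducible [CharZero k] {Q : Matrix (Fin N) (Fin N) k[X]} (hQ : Q.det ≠ 0) :
    IsIrreducible (CendQ Q) := by
  intro U hU
  by_contra! h
  obtain ⟨hb, ht⟩ := h
  obtain ⟨u, hu, hu0⟩ := U.exists_mem_ne_zero_of_ne_bot hb
  have hw : Q.mulVec u ≠ 0 := fun h => hu0 (Matrix.eq_zero_of_mulVec_eq_zero hQ h)
  obtain ⟨j, hj⟩ := Function.ne_iff.1 hw
  set w := Q.mulVec u with hwd
  set d := (w j).natDegree with hd
  apply ht
  have he : ∀ i, Pi.single i 1 ∈ U := by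
    intro i
    have hc : (C (((d.factorial : k) * (w j).leadingCoeff)) : k[X]) =
        derivative^[d] (w j) := by
      have : (derivative^[d] (w j)).natDegree ≤ 0 := by
        simpa [hd] using natDegree_iterate_derivative (w j) d
      rw [eq_C_of_natDegree_le_zero this, coeff_iterate_derivative, zero_add,
        Nat.descFactorial_self, nsmul_eq_mul, hd, coeff_natDegree]
    have h1 := hU (C (Matrix.single i j 1) * shift Q)
      ⟨C (Matrix.single i j 1), rfl⟩ d u hu
    rw [← actHom_apply, actHom_mul_shift, ← monomial_zero_left, actHom_monomial] at h1
    have h2 : (((-1) ^ 0 * (d.descFactorial 0 : k)) •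
        (Matrix.single i j (1 : k[X])).mulVec fun i => derivative^[d - 0] (w i)) =
        (C ((d.factorial : k) * (w j).leadingCoeff) : k[X]) • Pi.single i 1 := by
      rw [hc]
      ext1 l
      by_cases hl : l = i
      · subst hl
        simp [Matrix.single_mulVec]
      · simp [Matrix.single_mulVec, hl]
    rw [h2] at h1
    have hne : (d.factorial : k) * (w j).leadingCoeff ≠ 0 :=
      mul_ne_zero (Nat.cast_ne_zero.2 d.factorial_ne_zero) (leadingCoeff_ne_zero.2 hj)
    have h3 := U.smul_mem (C ((d.factorial : k) * (w j).leadingCoeff)⁻¹) h1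
    rwa [smul_smul, ← C_mul, inv_mul_cancel₀ hne, C_1, one_smul] at h3
  rw [eq_top_iff]
  intro x _
  rw [pi_eq_sum_univ' x]
  exact U.sum_mem fun i _ => U.smul_mem _ (he i)

lemma CendQ_ne_bot (hN : 0 < N) {Q : Matrix (Fin N) (Fin N) k[X]} (hQ : Q.det ≠ 0) :
    CendQ Q ≠ ⊥ := by
  intro h
  have h1 : (1 : Cend k N) * shift Q = 0 := by
    rw [← Submodule.mem_bot k, ← h]
    exact ⟨1, rfl⟩
  have h2 := actHom_mul_shift 0 1 Q (Pi.single ⟨0, hN⟩ 1)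
  rw [h1, show (1 : Cend k N) = monomial 0 1 from rfl, actHom_monomial, map_zero, LinearMap.zero_apply] at h2
  have h3 := Matrix.eq_zero_of_mulVec_eq_zero hQ (v := Pi.single ⟨0, hN⟩ 1) (by
    ext1 i
    simpa using (congrFun h2 i).symm)
  simpa using congrFun h3 ⟨0, hN⟩

lemma vMul_mem_CendQ {Q : Matrix (Fin N) (Fin N) k[X]} {a : Cend k N} (ha : a ∈ CendQ Q) :
    vMul a ∈ CendQ Q := by
  obtain ⟨b, rfl⟩ := ha
  exact ⟨vMul b, smul_mul_assoc _ _ _⟩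

/-! ### The filtration by powers of `v` -/

/-- `C + vC + ⋯ + v^(n-1) C`. -/
def vSum (n : ℕ) (C : Submodule k (Cend k N)) : Submodule k (Cend k N) :=
  (Finset.range n).sup fun i => vPow i C

lemma vSum_zero (C : Submodule k (Cend k N)) : vSum 0 C = ⊥ := by
  simp [vSum]

lemma vSum_succ (n : ℕ) (C : Submodule k (Cend k N)) : vSum (n + 1) C = vPow n C ⊔ vSum n C := by
  rw [vSum, Finset.range_add_one, Finset.sup_insert, vSum]

lemma iSupIndep_vPow_of_disjoint {C : Submodule k (Cend k N)}
    (h : ∀ n, Disjoint (vPow n C) (vSum n C)) : iSupIndep fun i => vPow i C := by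
  have hs : ∀ n, (Finset.range n).SupIndep fun i => vPow i C := by
    intro n
    induction n with
    | zero => exact Finset.supIndep_empty _
    | succ n ih =>
      rw [Finset.range_add_one]
      exact ih.insert (h n)
  rw [iSupIndep_iff_finsetSum_eq_zero_imp_eq_zero]
  intro s v hv h0
  obtain ⟨n, hn⟩ := s.exists_nat_subset_range
  have h1 := iSupIndep_comp_coe_iff_supIndep.2 ((hs n).subset hn)
  rw [iSupIndep_iff_finsetSum_eq_zero_imp_eq_zero] at h1
  intro i hi
  refine h1 s.attach (fun i => v i) (fun i _ => hv i i.2) ?_ ⟨i, hi⟩ (Finset.mem_attach _ _)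
  rw [← h0]
  exact s.sum_attach v

lemma vMul_pow_mem_vSum {C : Submodule k (Cend k N)} {i n : ℕ} (hi : i < n) {a : Cend k N}
    (ha : a ∈ C) : (vMul ^ i) a ∈ vSum n C :=
  (Finset.le_sup (f := fun i => vPow i C) (Finset.mem_range.2 hi) : vPow i C ≤ vSum n C)
    (Submodule.mem_map_of_mem ha)

/-- To check that a subspace contains the image of `vSum n C`, consider the elements `v^i a`. -/
lemma vSum_le_comap {C P : Submodule k (Cend k N)} {n : ℕ} (f : Cend k N →ₗ[k] Cend k N)
    (h : ∀ i < n, ∀ a ∈ C, f ((vMul ^ i) a) ∈ P) {x : Cend k N} (hx : x ∈ vSum n C) : f x ∈ P := by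
  have : vSum n C ≤ P.comap f := by
    refine Finset.sup_le fun i hi => ?_
    rintro _ ⟨a, ha, rfl⟩
    exact h i (Finset.mem_range.1 hi) a ha
  exact this hx

lemma vMul_injective : Function.Injective (vMul : Cend k N → Cend k N) := by
  intro a b h
  ext1 n
  ext1 i j
  have h1 := congrArg (fun c : Cend k N => c.coeff n i j) h
  simpa [vMul] using h1

lemma vMul_pow_injective (n : ℕ) : Function.Injective ((vMul ^ n : Cend k N →ₗ[k] Cend k N)) := by
  rw [Module.End.coe_pow]
  exact vMul_injective.iterate n

lemma nProdHom_vMul_pow_left (m n : ℕ) (a b : Cend k N) :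
    nProdHom m ((vMul ^ n) a) b = (vMul ^ n) (nProdHom m a b) := by
  induction n with
  | zero => rfl
  | succ n ih => simp only [pow_succ', Module.End.mul_apply, nProdHom_vMul_left, ih]

lemma nProdHom_mem {C : Submodule k (Cend k N)} (hC : IsConformalSubalgebra C) (m : ℕ)
    {a b : Cend k N} (ha : a ∈ C) (hb : b ∈ C) : nProdHom m a b ∈ C :=
  hC.nProd_mem m a ha b hb

lemma vMul_vSum {C : Submodule k (Cend k N)} (n : ℕ) {x : Cend k N} (hx : x ∈ vSum n C) :
    vMul x ∈ vSum (n + 1) C := by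
  refine vSum_le_comap vMul (fun i hi a ha => ?_) hx
  rw [← Module.End.mul_apply, ← pow_succ']
  exact vMul_pow_mem_vSum (by omega) ha

lemma vSum_mono {C : Submodule k (Cend k N)} {m n : ℕ} (h : m ≤ n) : vSum m C ≤ vSum n C :=
  Finset.sup_mono (Finset.range_mono h)

/-- `a ∘_m v^n b ≡ v^n (a ∘_m b)` modulo lower powers of `v`. -/
lemma nProdHom_vMul_pow_right {C : Submodule k (Cend k N)} (hC : IsConformalSubalgebra C)
    (n : ℕ) {a b : Cend k N} (ha : a ∈ C) (hb : b ∈ C) (m : ℕ) :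
    nProdHom m a ((vMul ^ n) b) - (vMul ^ n) (nProdHom m a b) ∈ vSum n C := by
  induction n generalizing m with
  | zero => simp
  | succ n ih =>
    have h1 := vMul_vSum n (ih m)
    have h2 := vSum_mono n.le_succ (ih (m - 1))
    have h3 := vMul_pow_mem_vSum n.lt_succ_self (nProdHom_mem hC (m - 1) ha hb)
    have h4 := add_mem h1 (nsmul_mem (add_mem h2 h3) m)
    rw [sub_add_cancel, map_sub] at h4
    rw [pow_succ', Module.End.mul_apply, Module.End.mul_apply, nProdHom_vMul_right]
    convert h4 using 1
    abel

/-- `a ∘_m v^(n+1) b ≡ v^(n+1) (a ∘_m b) + (n+1) m v^n (a ∘_(m-1) b)` modulo lower powers. -/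
lemma nProdHom_vMul_pow_succ_right {C : Submodule k (Cend k N)} (hC : IsConformalSubalgebra C)
    (n : ℕ) {a b : Cend k N} (ha : a ∈ C) (hb : b ∈ C) (m : ℕ) :
    nProdHom m a ((vMul ^ (n + 1)) b) - (vMul ^ (n + 1)) (nProdHom m a b) -
      (n + 1) • m • (vMul ^ n) (nProdHom (m - 1) a b) ∈ vSum n C := by
  induction n generalizing m with
  | zero =>
    simp [nProdHom_vMul_right]
  | succ n ih =>
    have h1 := vMul_vSum n (ih m)
    have h2 := nsmul_mem (nProdHom_vMul_pow_right hC (n + 1) ha hb (m - 1)) m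
    have h4 := add_mem h1 h2
    rw [pow_succ', Module.End.mul_apply, Module.End.mul_apply, nProdHom_vMul_right]
    simp only [map_sub, map_nsmul, smul_sub] at h4
    rw [← Module.End.mul_apply vMul (vMul ^ n), ← pow_succ'] at h4
    convert h4 using 1
    rw [succ_nsmul]
    abel

/-- With its right-hand counterpart, this lets congruences modulo lower powers be multiplied by
elements of `C`. -/
lemma nProdHom_vSum_left {C : Submodule k (Cend k N)} (hC : IsConformalSubalgebra C)
    (n m : ℕ) {x b : Cend k N} (hx : x ∈ vSum n C) (hb : b ∈ C) :
    nProdHom m x b ∈ vSum n C := by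
  refine vSum_le_comap ((nProdHom m).flip b) (fun i hi a ha => ?_) hx
  rw [LinearMap.flip_apply, nProdHom_vMul_pow_left]
  exact vMul_pow_mem_vSum hi (nProdHom_mem hC m ha hb)

lemma nProdHom_vSum_right {C : Submodule k (Cend k N)} (hC : IsConformalSubalgebra C)
    (n m : ℕ) {x b : Cend k N} (hx : x ∈ vSum n C) (hb : b ∈ C) :
    nProdHom m b x ∈ vSum n C := by
  refine vSum_le_comap (nProdHom m b) (fun i hi a ha => ?_) hx
  have h1 := vSum_mono hi.le (nProdHom_vMul_pow_right hC i hb ha m)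
  have h2 := add_mem h1 (vMul_pow_mem_vSum hi (nProdHom_mem hC m hb ha))
  rwa [sub_add_cancel] at h2

/-! ### Leading relations and the centroid element -/

/-- The relation `c = v a - ψ(a)`, where `ψ` is the centroid element attached to a relation
`v^(n+1) a ≡ (n+1) v^n c` modulo lower powers of `v`. -/
structure LeadingRel (C : Submodule k (Cend k N)) (n : ℕ) (a c : Cend k N) : Prop where
  left_mem : a ∈ C
  right_mem : c ∈ C
  modEq : (vMul ^ (n + 1)) a - (n + 1) • (vMul ^ n) c ∈ vSum n C

namespace LeadingRel

variable {C : Submodule k (Cend k N)} {n : ℕ} {a b c d : Cend k N}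

lemma nProd_left (h : LeadingRel C n a c) (hC : IsConformalSubalgebra C) (hb : b ∈ C) (m : ℕ) :
    LeadingRel C n (nProdHom m a b) (nProdHom m c b) where
  left_mem := nProdHom_mem hC m h.left_mem hb
  right_mem := nProdHom_mem hC m h.right_mem hb
  modEq := by
    have h1 := nProdHom_vSum_left hC n m h.modEq hb
    rwa [map_sub, LinearMap.sub_apply, nProdHom_vMul_pow_left, map_nsmul, LinearMap.smul_apply,
      nProdHom_vMul_pow_left] at h1

/-- Moving `v^(n+1)` out of the right factor costs `(n+1) m v^n (b ∘_(m-1) a)`. The coefficient `n +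
1` in `LeadingRel` makes this correction integral; it says `ψ(b ∘_m a) = b ∘_m ψ(a)`. -/
lemma nProd_right (h : LeadingRel C n a c) (hC : IsConformalSubalgebra C) (hb : b ∈ C) (m : ℕ) :
    LeadingRel C n (nProdHom m b a) (nProdHom m b c - m • nProdHom (m - 1) b a) where
  left_mem := nProdHom_mem hC m hb h.left_mem
  right_mem := sub_mem (nProdHom_mem hC m hb h.right_mem)
    (nsmul_mem (nProdHom_mem hC _ hb h.left_mem) m)
  modEq := by
    have h1 := nProdHom_vSum_right hC n m h.modEq hb
    have h2 := nProdHom_vMul_pow_succ_right hC n hb h.left_mem m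
    have h3 := nsmul_mem (nProdHom_vMul_pow_right hC n hb h.right_mem m) (n + 1)
    have h4 := sub_mem (add_mem h1 h3) h2
    convert h4 using 1
    simp only [map_sub, map_nsmul, smul_sub]
    abel

lemma unique [CharZero k] (hd : Disjoint (vPow n C) (vSum n C)) (h : LeadingRel C n a c)
    (h' : LeadingRel C n a d) : c = d := by
  have h1 := sub_mem h'.modEq h.modEq
  rw [sub_sub_sub_cancel_left, ← map_nsmul, ← map_nsmul, ← map_sub] at h1
  have h2 : (n + 1) • c - (n + 1) • d ∈ C :=
    sub_mem (nsmul_mem h.right_mem _) (nsmul_mem h'.right_mem _)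
  have h3 := Submodule.disjoint_def.1 hd _ (Submodule.mem_map_of_mem h2) h1
  have h4 := sub_eq_zero.1 (vMul_pow_injective n (h3.trans (map_zero _).symm))
  rw [← Nat.cast_smul_eq_nsmul k, ← Nat.cast_smul_eq_nsmul k] at h4
  exact smul_right_injective _ (Nat.cast_ne_zero.2 n.succ_ne_zero) h4

/-- That is, `ψ(a) ∘_m b = a ∘_m ψ(b)`: both sides come from relations for the same element `a ∘_m
b`. -/
lemma nProd_eq [CharZero k] (hC : IsConformalSubalgebra C) (hd : Disjoint (vPow n C) (vSum n C))
    (h : LeadingRel C n a c) (h' : LeadingRel C n b d) (m : ℕ) :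
    nProdHom m c b = nProdHom m a d - m • nProdHom (m - 1) a b :=
  unique hd (h.nProd_left hC h'.left_mem m) (h'.nProd_right hC h.left_mem m)

end LeadingRel

/-! ### The induced operator on `V_N` -/

/-- The graph of multiplication by `X` minus the operator on `V_N` induced by `ψ`. -/
def leadingGraph (C : Submodule k (Cend k N)) (n : ℕ) :
    Submodule k[X] ((Fin N → k[X]) × (Fin N → k[X])) :=
  Submodule.span k[X] {p | ∃ a c, LeadingRel C n a c ∧ ∃ m u, p = (actHom m a u, actHom m c u)}

/-- The operators `a ∘_m` are linear over `k` only and obey a Leibniz rule for `X`, so scalars are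
treated as constants and single factors `X`. -/
lemma span_induction_X {M : Type*} [AddCommGroup M] [Module k[X] M] {S : Set M} {p : M → Prop}
    (mem : ∀ x ∈ S, p x) (zero : p 0) (add : ∀ x y, p x → p y → p (x + y))
    (const : ∀ (c : k) x, p x → p ((C c : k[X]) • x)) (var : ∀ x, p x → p ((X : k[X]) • x))
    {x : M} (hx : x ∈ Submodule.span k[X] S) : p x := by
  induction hx using Submodule.span_induction with
  | mem x h => exact mem x h
  | zero => exact zero
  | add x y _ _ hx hy => exact add x y hx hy
  | smul q x _ hx =>
    induction q using Polynomial.induction_on with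
    | C c => exact const c x hx
    | add q r hq hr => rw [add_smul]; exact add _ _ hq hr
    | monomial m c h =>
      rw [pow_succ, ← mul_assoc, mul_comm, mul_smul]
      exact var _ h

lemma actHom_C_smul (n : ℕ) (a : Cend k N) (c : k) (u : Fin N → k[X]) :
    actHom n a ((C c : k[X]) • u) = (C c : k[X]) • actHom n a u := by
  rw [← algebraMap_eq, algebraMap_smul, algebraMap_smul, map_smul]

lemma smul_actHom_pred_actHom (m l : ℕ) (b a : Cend k N) (u : Fin N → k[X]) :
    m • actHom (m - 1) b (actHom l a u) = ∑ s ∈ Finset.range (m + 1),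
      m.choose s • s • actHom (m + l - s) (nProdHom (s - 1) b a) u := by
  rw [sum_choose_smul (f := fun s => actHom (m + l - s) (nProdHom (s - 1) b a) u),
    actHom_actHom]
  cases m with
  | zero => simp
  | succ m =>
    congr 1
    refine Finset.sum_congr rfl fun s _ => ?_
    rw [show m + 1 - 1 + l - s = m + 1 + l - (s + 1) by omega, Nat.add_sub_cancel s 1]

variable {C : Submodule k (Cend k N)} {n : ℕ}

lemma actHom_pair_mem_leadingGraph {a c : Cend k N} (h : LeadingRel C n a c) (m : ℕ)
    (u : Fin N → k[X]) : (actHom m a u, actHom m c u) ∈ leadingGraph C n :=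
  Submodule.subset_span ⟨a, c, h, m, u, rfl⟩

/-- In terms of `T = X - θ`, this says that `T` commutes with every `b ∘_m`. -/
lemma actHom_mem_leadingGraph (hC : IsConformalSubalgebra C)
    {p : (Fin N → k[X]) × (Fin N → k[X])} (hp : p ∈ leadingGraph C n) {b : Cend k N} (hb : b ∈ C)
    (m : ℕ) :
    (actHom m b p.1, actHom m b p.2 - m • actHom (m - 1) b p.1) ∈ leadingGraph C n := by
  revert m
  rw [leadingGraph] at hp
  refine span_induction_X (M := (Fin N → k[X]) × (Fin N → k[X])) (p := fun p => ∀ m, (actHom m b p.1,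
    actHom m b p.2 - m • actHom (m - 1) b p.1) ∈ leadingGraph C n) ?_ ?_ ?_ ?_ ?_ hp
  · rintro _ ⟨a, c, h, l, u, rfl⟩ m
    have h1 : ∑ s ∈ Finset.range (m + 1), m.choose s • (actHom (m + l - s) (nProdHom s b a) u,
        actHom (m + l - s) (nProdHom s b c - s • nProdHom (s - 1) b a) u) ∈ leadingGraph C n :=
      sum_mem fun s _ => nsmul_mem (actHom_pair_mem_leadingGraph
        (h.nProd_right hC hb s) _ u) _
    convert h1 using 1
    rw [Prod.ext_iff, Prod.fst_sum, Prod.snd_sum]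
    refine ⟨actHom_actHom m l b a u, ?_⟩
    simp only [Prod.smul_snd, map_sub, LinearMap.sub_apply, smul_sub, Finset.sum_sub_distrib,
      map_nsmul, LinearMap.smul_apply]
    rw [actHom_actHom, smul_actHom_pred_actHom]
  · intro m
    simp only [Prod.fst_zero, Prod.snd_zero, map_zero, smul_zero, sub_zero]
    exact zero_mem (leadingGraph C n)
  · intro x y hx hy m
    have h1 := add_mem (hx m) (hy m)
    convert h1 using 1
    simp only [Prod.fst_add, Prod.snd_add, map_add, smul_add, Prod.mk_add_mk]
    congr 1
    abel
  · intro c x hx m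
    have h1 := (leadingGraph C n).smul_mem (Polynomial.C c) (hx m)
    convert h1 using 1
    simp only [Prod.smul_fst, Prod.smul_snd, actHom_C_smul, Prod.smul_mk, smul_sub]
    rw [smul_comm m (Polynomial.C c : k[X])]
  · intro x hx m
    have h1 := add_mem ((leadingGraph C n).smul_mem X (hx m)) (nsmul_mem (hx (m - 1)) m)
    convert h1 using 1
    simp only [Prod.smul_fst, Prod.smul_snd, actHom_X_smul, Prod.smul_mk, smul_sub, smul_add,
      Prod.mk_add_mk]
    rw [smul_comm (X : k[X]) m]
    congr 1
    abel

/-- The analogue of `ψ(a) ∘_m w = a ∘_m (T w)`. It does not presuppose that the graph is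
single-valued and serves to prove it. -/
lemma LeadingRel.actHom_eq [CharZero k] (hC : IsConformalSubalgebra C)
    (hd : Disjoint (vPow n C) (vSum n C)) {a c : Cend k N} (h : LeadingRel C n a c)
    {p : (Fin N → k[X]) × (Fin N → k[X])} (hp : p ∈ leadingGraph C n) (m : ℕ) :
    actHom m c p.1 = actHom m a p.2 - m • actHom (m - 1) a p.1 := by
  revert m
  rw [leadingGraph] at hp
  refine span_induction_X (M := (Fin N → k[X]) × (Fin N → k[X])) (p := fun p => ∀ m, actHom m c p.1 =
    actHom m a p.2 - m • actHom (m - 1) a p.1) ?_ ?_ ?_ ?_ ?_ hp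
  · rintro _ ⟨b, d, h', l, u, rfl⟩ m
    rw [smul_actHom_pred_actHom, actHom_actHom, actHom_actHom]
    simp only [h.nProd_eq hC hd h', map_sub, LinearMap.sub_apply, smul_sub, map_nsmul,
      Finset.sum_sub_distrib, LinearMap.smul_apply]
  · intro m
    simp
  · intro x y hx hy m
    simp only [Prod.fst_add, Prod.snd_add, map_add, smul_add, hx, hy]
    abel
  · intro c x hx m
    simp only [Prod.smul_fst, Prod.smul_snd, actHom_C_smul, hx, smul_sub]
    rw [smul_comm m (Polynomial.C c : k[X])]
  · intro x hx m
    simp only [Prod.smul_fst, Prod.smul_snd, actHom_X_smul, hx, smul_sub, smul_add]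
    rw [smul_comm (X : k[X]) m]
    abel

/-! ### The Schur lemma argument -/

/-- A `k[X]`-endomorphism of `k[X]^N`, shifted by a suitable scalar, is not surjective. -/
lemma exists_mulVec_ne [IsAlgClosed k] (hN : 0 < N) (M : Matrix (Fin N) (Fin N) k[X]) :
    ∃ (α : k) (i : Fin N), ∀ w : Fin N → k[X],
      (X : k[X]) • w - M.mulVec w - (Polynomial.C α : k[X]) • w ≠ Pi.single i 1 := by
  have : Nonempty (Fin N) := ⟨⟨0, hN⟩⟩
  -- At `X = 0` the operator becomes `-M(0) - α`. A left eigenvector `y` of `-M(0)` annihilates its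
  -- image, but pairs nontrivially with `e_i` when `y_i ≠ 0`.
  obtain ⟨α, hα⟩ := Module.End.exists_eigenvalue (Matrix.vecMulLinear (-(M.map (eval 0))))
  obtain ⟨y, hy, hy0⟩ := hα.exists_hasEigenvector
  rw [Module.End.mem_eigenspace_iff, Matrix.vecMulLinear_apply] at hy
  obtain ⟨i, hi⟩ := Function.ne_iff.1 hy0
  refine ⟨α, i, fun w hw => hi ?_⟩
  have h1 : (-(M.map (eval 0))).mulVec (fun j => eval 0 (w j)) - α • (fun j => eval 0 (w j)) =
      Pi.single i 1 := by
    ext1 j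
    have h2 := congrArg (eval 0) (congrFun hw j)
    simp only [Pi.sub_apply, Pi.smul_apply, smul_eq_mul, eval_sub, eval_mul, eval_X, eval_C,
      zero_mul, zero_sub, Matrix.mulVec, dotProduct, eval_finsetSum] at h2
    simp only [Matrix.neg_mulVec, Pi.sub_apply, Pi.neg_apply, Matrix.mulVec, dotProduct,
      Matrix.map_apply, Pi.smul_apply, smul_eq_mul]
    rw [h2]
    by_cases hj : j = i
    · subst hj; simp
    · simp [hj]
  have h3 := congrArg (fun x => y ⬝ᵥ x) h1
  simpa [dotProduct_sub, Matrix.dotProduct_mulVec, hy, sub_self] using h3.symm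

/-- The operator attached to a leading relation is a scalar, so `v a` lies in `C`. -/
lemma LeadingRel.eq_zero [IsAlgClosed k] [CharZero k] (hN : 0 < N)
    (hC : IsConformalSubalgebra C) (hirr : IsIrreducible C) (hcap : C ⊓ vPow 1 C = ⊥)
    (hd : Disjoint (vPow n C) (vSum n C)) {a c : Cend k N} (h : LeadingRel C n a c) : a = 0 := by
  by_contra ha
  have hG : ∀ m u, (actHom m a u, actHom m c u) ∈ leadingGraph C n := actHom_pair_mem_leadingGraph h
  have hfst : (leadingGraph C n).map (LinearMap.fst k[X] (Fin N → k[X]) (Fin N → k[X])) = ⊤ := by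
    refine (hirr _ ?_).resolve_left fun hb => ha (actHom_faithful fun m u => ?_)
    · rintro b hb m _ ⟨p, hp, rfl⟩
      exact ⟨_, actHom_mem_leadingGraph hC hp hb m, rfl⟩
    · rw [← Submodule.mem_bot k[X], ← hb]
      exact ⟨_, hG m u, rfl⟩
  -- The fibre over 0 is stable under `C`. Were it all of `V_N`, `LeadingRel.actHom_eq` at `(0, u)`
  -- would make `a` act by zero.
  have hker : (leadingGraph C n).comap (LinearMap.inr k[X] (Fin N → k[X]) (Fin N → k[X])) = ⊥ := by
    refine (hirr _ ?_).resolve_right fun ht => ha (actHom_faithful fun m u => ?_)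
    · intro b hb m w hw
      have h1 := actHom_mem_leadingGraph hC hw hb m
      rw [LinearMap.inr_apply] at h1
      simp only [map_zero, smul_zero, sub_zero] at h1
      exact h1
    · have hu : u ∈ (⊤ : Submodule k[X] (Fin N → k[X])) := trivial
      rw [← ht] at hu
      simpa using (h.actHom_eq hC hd hu m).symm
  have hex : ∀ i : Fin N, ∃ w, ((Pi.single i 1 : Fin N → k[X]), w) ∈ leadingGraph C n := by
    intro i
    have hi : (Pi.single i 1 : Fin N → k[X]) ∈ (⊤ : Submodule k[X] (Fin N → k[X])) := trivial
    rw [← hfst] at hi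
    obtain ⟨⟨_, w⟩, hp, rfl⟩ := hi
    exact ⟨w, hp⟩
  choose g hg using hex
  have hM : ∀ p ∈ leadingGraph C n, p.2 = (Matrix.of fun i j => g j i).mulVec p.1 := by
    intro p hp
    have h1 : ∑ i, p.1 i • ((Pi.single i 1 : Fin N → k[X]), g i) ∈ leadingGraph C n :=
      sum_mem fun i _ => Submodule.smul_mem _ _ (hg i)
    have h2 : ∑ i, p.1 i • ((Pi.single i 1 : Fin N → k[X]), g i) =
        (p.1, (Matrix.of fun i j => g j i).mulVec p.1) := by
      rw [Prod.ext_iff, Prod.fst_sum, Prod.snd_sum]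
      refine ⟨(pi_eq_sum_univ' p.1).symm, ?_⟩
      ext1 i
      simp [Matrix.mulVec, dotProduct, mul_comm]
    have h3 := sub_mem hp (h2 ▸ h1)
    have h4 : p.2 - (Matrix.of fun i j => g j i).mulVec p.1 ∈
        (leadingGraph C n).comap (LinearMap.inr k[X] (Fin N → k[X]) (Fin N → k[X])) := by
      simpa [Prod.sub_def] using h3
    rw [hker, Submodule.mem_bot] at h4
    exact sub_eq_zero.1 h4
  obtain ⟨α, i, hα⟩ := exists_mulVec_ne hN (Matrix.of fun i j => g j i)
  let f : (Fin N → k[X]) × (Fin N → k[X]) →ₗ[k[X]] (Fin N → k[X]) :=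
    (X : k[X]) • LinearMap.fst _ _ _ - LinearMap.snd _ _ _ -
      (Polynomial.C α : k[X]) • LinearMap.fst _ _ _
  have hf : ∀ p, f p = (X : k[X]) • p.1 - p.2 - (Polynomial.C α : k[X]) • p.1 := fun p => rfl
  -- The image of `T - α` is stable under `C`, and misses `e_i` by the choice of `α`.
  have hbot : (leadingGraph C n).map f = ⊥ := by
    refine (hirr _ ?_).resolve_right fun ht => ?_
    · rintro b hb m _ ⟨p, hp, rfl⟩
      refine ⟨_, actHom_mem_leadingGraph hC hp hb m, ?_⟩
      rw [hf, hf, ← actHom_apply]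
      simp only [map_sub, actHom_X_smul, actHom_C_smul]
      abel
    · have hi : (Pi.single i 1 : Fin N → k[X]) ∈ (⊤ : Submodule k[X] (Fin N → k[X])) := trivial
      rw [← ht] at hi
      obtain ⟨p, hp, hpi⟩ := hi
      rw [hf, hM p hp] at hpi
      exact hα _ hpi
  have hv : vMul a - c - α • a = 0 := actHom_faithful fun m u => by
    have h1 : f (actHom m a u, actHom m c u) ∈ (leadingGraph C n).map f :=
      Submodule.mem_map_of_mem (hG m u)
    rw [hbot, Submodule.mem_bot, hf] at h1
    rw [map_sub, map_sub, LinearMap.sub_apply, LinearMap.sub_apply, actHom_vMul, map_smul,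
      LinearMap.smul_apply, ← h1, ← algebraMap_eq, algebraMap_smul]
  have hvC : vMul a ∈ C := by
    rw [sub_sub, sub_eq_zero] at hv
    rw [hv]
    exact add_mem h.right_mem (C.smul_mem α h.left_mem)
  have hv0 : vMul a ∈ C ⊓ vPow 1 C := ⟨hvC, a, h.left_mem, by rw [pow_one]⟩
  rw [hcap, Submodule.mem_bot] at hv0
  exact ha (vMul_injective (hv0.trans (map_zero _).symm))

theorem iSupIndep_vPow_of_isIrreducible [IsAlgClosed k] [CharZero k] (hN : 0 < N)
    (hC : IsConformalSubalgebra C) (hirr : IsIrreducible C) (hcap : C ⊓ vPow 1 C = ⊥) :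
    iSupIndep fun i => vPow i C := by
  refine iSupIndep_vPow_of_disjoint fun n => ?_
  induction n with
  | zero => rw [vSum_zero]; exact disjoint_bot_right
  | succ n hd =>
    rw [Submodule.disjoint_def]
    rintro _ ⟨a, ha, rfl⟩ hx
    rw [vSum_succ, Submodule.mem_sup] at hx
    obtain ⟨_, ⟨c, hc, rfl⟩, y, hy, hxy⟩ := hx
    have hn : ((n + 1 : ℕ) : k) ≠ 0 := Nat.cast_ne_zero.2 n.succ_ne_zero
    have h : LeadingRel C n a (((n + 1 : ℕ) : k)⁻¹ • c) := by
      refine ⟨ha, C.smul_mem _ hc, ?_⟩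
      rw [← hxy, map_smul, ← Nat.cast_smul_eq_nsmul k, smul_smul, mul_inv_cancel₀ hn, one_smul,
        add_sub_cancel_left]
      exact hy
    rw [h.eq_zero hN hC hirr hcap hd, map_zero]

/-! ### Passing between `C` and `Cend_{N,Q}` -/

lemma vPow_zero : vPow 0 C = C := by
  rw [vPow, pow_zero]
  exact Submodule.map_id C

lemma vMul_pow_mem_CendQ {Q : Matrix (Fin N) (Fin N) k[X]} {a : Cend k N} (ha : a ∈ CendQ Q)
    (i : ℕ) : (vMul ^ i) a ∈ CendQ Q := by
  induction i with
  | zero => exact ha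
  | succ i ih =>
    rw [pow_succ', Module.End.mul_apply]
    exact vMul_mem_CendQ ih

lemma actHom_vMul_pow (m i : ℕ) (a : Cend k N) (u : Fin N → k[X]) :
    actHom m ((vMul ^ i) a) u = (X ^ i : k[X]) • actHom m a u := by
  induction i with
  | zero => rw [pow_zero, pow_zero, one_smul]; rfl
  | succ i ih => rw [pow_succ', Module.End.mul_apply, actHom_vMul, ih, smul_smul, ← pow_succ']

/-- Since `v` acts as multiplication by `D`, an `H`-submodule stable under `C` is stable under each
`v^i C`. -/
lemma isIrreducible_of_iSup_vPow {n : ℕ} (h : IsIrreducible (⨆ i : Fin (n + 1), vPow (i : ℕ) C)) :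
    IsIrreducible C := by
  intro U hU
  refine h U fun a ha m u hu => ?_
  have : (⨆ i : Fin (n + 1), vPow (i : ℕ) C) ≤
      (U.restrictScalars k).comap ((actHom m).flip u) := by
    refine iSup_le fun i => ?_
    rintro _ ⟨a, ha, rfl⟩
    simp only [Submodule.mem_comap, LinearMap.flip_apply, Submodule.restrictScalars_mem,
      actHom_vMul_pow]
    exact U.smul_mem _ (hU a ha m u hu)
  exact this ha

end Conformal

end

theorem theorem5p4p1 {k : Type*} [Field k] [IsAlgClosed k] [CharZero k] (N : ℕ) (hN : 0 < N) :
    (∀ Q : Matrix (Fin N) (Fin N) k[X], Q.det ≠ 0 →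
      ∀ C : Submodule k (Conformal.Cend k N), Conformal.IsConformalSubalgebra C →
        ∀ n : ℕ,
          iSupIndep (fun i : Fin (n + 1) => Conformal.vPow (i : ℕ) C) →
          (⨆ i : Fin (n + 1), Conformal.vPow (i : ℕ) C) = Conformal.CendQ Q →
          n = 0) ∧
    (∀ C : Submodule k (Conformal.Cend k N),
      Conformal.IsConformalSubalgebra C → Conformal.IsIrreducible C →
        ¬ (C ⊓ Conformal.vPow 1 C = ⊥ ∧
            ¬ iSupIndep (fun i : ℕ => Conformal.vPow i C))) := by
  constructor
  · intro Q hQ C hC n hind hsup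
    by_contra hn
    have hirr : Conformal.IsIrreducible C :=
      Conformal.isIrreducible_of_iSup_vPow (hsup ▸ Conformal.CendQ_isIrreducible hQ)
    have hcap : C ⊓ Conformal.vPow 1 C = ⊥ := by
      have h1 := hind.pairwiseDisjoint (i := ⟨0, by omega⟩) (j := ⟨1, by omega⟩) (by simp)
      have h2 : Disjoint (Conformal.vPow 0 C) (Conformal.vPow 1 C) := h1
      rwa [Conformal.vPow_zero, disjoint_iff] at h2
    have hall := Conformal.iSupIndep_vPow_of_isIrreducible hN hC hirr hcap
    have hle : C ≤ Conformal.CendQ Q := by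
      rw [← hsup]
      exact Conformal.vPow_zero.symm.le.trans
        (le_iSup (fun i : Fin (n + 1) => Conformal.vPow (i : ℕ) C) 0)
    apply Conformal.CendQ_ne_bot hN hQ
    have hC0 : C = ⊥ := by
      rw [eq_bot_iff]
      intro a ha
      -- `Cend_{N,Q}` is closed under `v`, so `v^(n+1) a` falls back into the sum of the powers up
      -- to `n`.
      have h1 : (Conformal.vMul ^ (n + 1)) a ∈ ⨆ j, ⨆ (_ : j ≠ n + 1), Conformal.vPow j C := by
        have h2 := Conformal.vMul_pow_mem_CendQ (hle ha) (n + 1)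
        rw [← hsup] at h2
        have h3 : (⨆ i : Fin (n + 1), Conformal.vPow (i : ℕ) C) ≤
            ⨆ j, ⨆ (_ : j ≠ n + 1), Conformal.vPow j C :=
          iSup_le fun i => le_iSup₂_of_le (i : ℕ) i.2.ne le_rfl
        exact h3 h2
      have h4 := Submodule.disjoint_def.1 (hall (n + 1)) _ (Submodule.mem_map_of_mem ha) h1
      exact Conformal.vMul_pow_injective (n + 1) (h4.trans (map_zero _).symm)
    rw [← hsup, hC0]
    simp [Conformal.vPow]
  · rintro C hC hirr ⟨hcap, hnot⟩
    exact hnot (Conformal.iSupIndep_vPow_of_isIrreducible hN hC hirr hcap)
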